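/- Let $\omega_1,\omega_2\in\mathbb C$ be linearly independent over $\mathbb R$ with $\operatorname{Im}(\omega_2/\omega_1)>0$, let $\Lambda=\{m_1\omega_1+m_2\omega_2 : m_1,m_2\in\mathbb Z\}$, and let $z\in\mathbb C\setminus\Lambda$. Put $$\wp(z)=\frac1{z^2}+\sum_{\omega\in\Lambda\setminus\{0\}}\left[\frac1{(z-\omega)^2}-\frac1{\omega^2}\right],\qquad \zeta(z)=\zeta(z;\omega_1,\omega_2)=\frac1z+\sum_{\omega\in\Lambda\setminus\{0\}}\left[\frac1{z-\omega}+\frac1\omega+\frac z{\omega^2}\right],$$ $$g_2=60\sum_{\omega\in\Lambda\setminus\{0\}}\omega^{-4},\qquad \eta_k=2\,\zeta(\omega_k/2;\omega_1,\omega_2)\quad(k=1,2),$$ and let $\wp'$ be the derivative of $\wp$ with respect to $z$. Then, for fixed $z$, the complex partial derivatives of $\zeta(z;\omega_1,\omega_2)$ with respect to the periods $\omega_1$ and $\omega_2$ exist and are equal to $$\frac{\partial\zeta(z)}{\partial\omega_1}=\frac1{2\pi i}\left[\frac12\,\omega_2\wp'(z)+(\omega_2\zeta(z)-\eta_2z)\wp(z)+\eta_2\zeta(z)-\frac{\omega_2g_2}{12}\,z\right],$$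 $$\frac{\partial\zeta(z)}{\partial\omega_2}=-\frac1{2\pi i}\left[\frac12\,\omega_1\wp'(z)+(\omega_1\zeta(z)-\eta_1z)\wp(z)+\eta_1\zeta(z)-\frac{\omega_1g_2}{12}\,z\right].$$ -/

import Mathlib

/-- The Weierstrass zeta function
`ζ(z; ω₁, ω₂) = 1 / z + ∑' [1 / (z - ω) + 1 / ω + z / ω ^ 2]`, where `ω = m₁ ω₁ + m₂ ω₂` and the
sum runs over all pairs of integers `(m₁, m₂) ≠ (0, 0)`. -/
noncomputable def weierstrassZeta (ω₁ ω₂ z : ℂ) : ℂ :=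
  1 / z + ∑' m : {m : ℤ × ℤ // m ≠ 0},
    (1 / (z - (m.1.1 * ω₁ + m.1.2 * ω₂)) + 1 / (m.1.1 * ω₁ + m.1.2 * ω₂)
      + z / (m.1.1 * ω₁ + m.1.2 * ω₂) ^ 2)

/-- The quasi-period `η₁ = 2 ζ(ω₁ / 2; ω₁, ω₂)`. -/
noncomputable def weierstrassEta₁ (ω₁ ω₂ : ℂ) : ℂ := 2 * weierstrassZeta ω₁ ω₂ (ω₁ / 2)

/-- The quasi-period `η₂ = 2 ζ(ω₂ / 2; ω₁, ω₂)`. -/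
noncomputable def weierstrassEta₂ (ω₁ ω₂ : ℂ) : ℂ := 2 * weierstrassZeta ω₁ ω₂ (ω₂ / 2)

open Filter Topology

namespace PeriodPair

variable (L : PeriodPair)

/-! An additive map c : Λ → ℂ is a direction in which to move the periods: l becomes l + t c(l).
Differentiating ζ termwise at t = 0 gives S_c(z) = ∑ c(l) [1/(z-l)² - 1/l² - 2z/l³], which is linear
in c. The two coordinate maps give the required partial derivatives S₁, S₂, and two other weights
give sums in closed form.

For c(l) = l the direction is a rescaling, and S_c = z℘ - ζ, Euler's relation for the homogeneous
function ζ. For c = η, the quasi-period homomorphism, S_η = ½℘' + ζ℘ - g₂z/12. To see this, let D be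
the difference of the two sides. A translation by l₀ adds η(l₀)℘ to both S_η and ζ℘, so D changes by
an affine function; as D is odd, that function is constant. The poles of D at 0 cancel, so D'
extends to an entire periodic function. It is constant by Liouville, and zero because D'(0) = 0;
then D = 0 because D(0) = 0.

Hence ω₁S₁ + ω₂S₂ and η₁S₁ + η₂S₂ are known. The determinant of this linear system is η₁ω₂ - η₂ω₁ =
2πi by Legendre's relation, which is proved by summing ζ along rows into cotangents. -/

lemma ω₁_ne_zero : L.ω₁ ≠ 0 := fun h ↦ L.ω₁_div_two_notMem_lattice (by simp [h])

/-! ### Weighted lattice sums -/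

lemma exists_mul_norm_le_norm_sub {z : ℂ} (hz : z ∈ ((L.lattice : Set ℂ) \ {0})ᶜ) :
    ∃ c > 0, ∃ ε > 0, ∀ w ∈ Metric.ball z ε, ∀ l : L.lattice, l ≠ 0 →
      c * ‖(l : ℂ)‖ ≤ ‖w - l‖ := by
  obtain ⟨d, hd, hball⟩ := Metric.isOpen_iff.mp (L.isOpen_compl_lattice_sdiff (s := {0})) z hz
  have hdist (l : L.lattice) (hl : l ≠ 0) : d ≤ ‖z - l‖ := by
    by_contra! h
    refine hball (a := (l : ℂ)) ?_ ⟨l.2, by simpa using hl⟩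
    rwa [Metric.mem_ball, dist_comm, dist_eq_norm]
  -- With d a lower bound for |z - l|, moving z by less than d/2 at most halves |z - l|, while |l| ≤
  -- |z| + |z - l| ≤ (|z|/d + 1)|z - l|.
  refine ⟨(2 * (‖z‖ / d + 1))⁻¹, by positivity, d / 2, by positivity, fun w hw l hl ↦ ?_⟩
  have h1 := hdist l hl
  rw [Metric.mem_ball, dist_eq_norm] at hw
  have h2 : ‖z - l‖ ≤ ‖w - z‖ + ‖w - l‖ := by
    simpa [norm_sub_rev] using norm_sub_le_norm_sub_add_norm_sub z w (l : ℂ)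
  have h3 : ‖(l : ℂ)‖ ≤ ‖z‖ + ‖z - l‖ := by
    simpa using norm_sub_le z (z - l)
  rw [inv_mul_le_iff₀ (by positivity)]
  have h4 : ‖z‖ = ‖z‖ / d * d := by field_simp
  have h5 : 0 ≤ ‖z‖ / d := by positivity
  nlinarith

/-- The summand of `PeriodPair.weightedSum`. -/
noncomputable def weightedSummand (c : L.lattice → ℂ) (l : L.lattice) (z : ℂ) : ℂ :=
  c l * (1 / ((z - l) ^ 2 * l ^ 2) - 2 / ((z - l) * l ^ 3))

/-- The sum over the nonzero lattice points `l` of `c l` times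
`(1 / (z - l) ^ 2 - 1 / l ^ 2 - 2 * z / l ^ 3) / z ^ 2`. -/
noncomputable def weightedSum (c : L.lattice → ℂ) (z : ℂ) : ℂ :=
  ∑' l : L.lattice, L.weightedSummand c l z

/-- The remainder `(ζ z - 1 / z) / z ^ 3`. -/
noncomputable def zetaRemainder (z : ℂ) : ℂ :=
  ∑' l : L.lattice, 1 / ((z - l) * (l : ℂ) ^ 3)

variable {L} in
lemma sub_coe_ne_zero {z : ℂ} (hz : z ∈ ((L.lattice : Set ℂ) \ {0})ᶜ) {l : L.lattice}
    (hl : l ≠ 0) : z - l ≠ 0 := by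
  intro h
  rw [sub_eq_zero] at h
  exact hz ⟨h ▸ l.2, by simpa [h] using hl⟩

variable {L} in
lemma differentiableOn_weightedSummand (c : L.lattice → ℂ) (l : L.lattice) :
    DifferentiableOn ℂ (L.weightedSummand c l) ((L.lattice : Set ℂ) \ {0})ᶜ := by
  by_cases hl : l = 0
  · have : L.weightedSummand c l = fun _ ↦ 0 := by ext; simp [weightedSummand, hl]
    rw [this]
    exact differentiableOn_const _
  · have hl' : (l : ℂ) ≠ 0 := by simpa using hl
    intro z hz
    have := sub_coe_ne_zero hz hl
    unfold weightedSummand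
    exact DifferentiableAt.differentiableWithinAt (by fun_prop (disch := simp [this, hl']))

variable {L} in
lemma hasDerivAt_zetaRemainder_summand (l : L.lattice) {z : ℂ}
    (hz : z ∈ ((L.lattice : Set ℂ) \ {0})ᶜ) :
    HasDerivAt (fun z : ℂ ↦ 1 / ((z - l) * (l : ℂ) ^ 3)) (-1 / ((z - l) ^ 2 * (l : ℂ) ^ 3)) z := by
  by_cases hl : l = 0
  · simpa [hl] using hasDerivAt_const z (0 : ℂ)
  · have hl' : (l : ℂ) ≠ 0 := by simpa using hl
    have h := sub_coe_ne_zero hz hl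
    convert! (((hasDerivAt_id z).sub_const (l : ℂ)).mul_const ((l : ℂ) ^ 3)).fun_inv
      (by simp [h, hl']) using 1
    · ext; simp
    · simp; field_simp

lemma exists_norm_weightedSummand_le (c : L.lattice → ℂ) {z : ℂ}
    (hz : z ∈ ((L.lattice : Set ℂ) \ {0})ᶜ) :
    ∃ M, ∃ ε > 0, ∀ l : L.lattice, ∀ w ∈ Metric.ball z ε,
      ‖L.weightedSummand c l w‖ ≤ M * (‖c l‖ / ‖(l : ℂ)‖ ^ 4) := by
  obtain ⟨a, ha, ε, hε, h⟩ := L.exists_mul_norm_le_norm_sub hz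
  refine ⟨(a ^ 2)⁻¹ + 2 * a⁻¹, ε, hε, fun l w hw ↦ ?_⟩
  by_cases hl : l = 0
  · simp [weightedSummand, hl]
  have hl' : 0 < ‖(l : ℂ)‖ := by simpa using hl
  have h1 := h w hw l hl
  have h2 : 0 < a * ‖(l : ℂ)‖ := by positivity
  calc ‖L.weightedSummand c l w‖
      ≤ ‖c l‖ * (1 / (‖w - l‖ ^ 2 * ‖(l : ℂ)‖ ^ 2) + 2 / (‖w - l‖ * ‖(l : ℂ)‖ ^ 3)) := by
        rw [weightedSummand, norm_mul]
        gcongr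
        refine (norm_sub_le _ _).trans (le_of_eq ?_)
        simp
    _ ≤ ‖c l‖ * (1 / ((a * ‖(l : ℂ)‖) ^ 2 * ‖(l : ℂ)‖ ^ 2) +
          2 / ((a * ‖(l : ℂ)‖) * ‖(l : ℂ)‖ ^ 3)) := by gcongr
    _ = _ := by field_simp

lemma exists_norm_zetaRemainder_summand_le {z : ℂ}
    (hz : z ∈ ((L.lattice : Set ℂ) \ {0})ᶜ) :
    ∃ M, ∃ ε > 0, ∀ l : L.lattice, ∀ w ∈ Metric.ball z ε,
      ‖1 / ((w - l) * (l : ℂ) ^ 3)‖ ≤ M * (‖(1 : ℂ)‖ / ‖(l : ℂ)‖ ^ 4) := by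
  obtain ⟨a, ha, ε, hε, h⟩ := L.exists_mul_norm_le_norm_sub hz
  refine ⟨a⁻¹, ε, hε, fun l w hw ↦ ?_⟩
  by_cases hl : l = 0
  · simp [hl]
  have hl' : 0 < ‖(l : ℂ)‖ := by simpa using hl
  have h1 := h w hw l hl
  have h2 : 0 < a * ‖(l : ℂ)‖ := by positivity
  calc ‖1 / ((w - l) * (l : ℂ) ^ 3)‖ = 1 / (‖w - l‖ * ‖(l : ℂ)‖ ^ 3) := by simp
    _ ≤ 1 / ((a * ‖(l : ℂ)‖) * ‖(l : ℂ)‖ ^ 3) := by gcongr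
    _ = _ := by simp; field_simp

lemma summable_norm_inv_pow {n : ℕ} (hn : 2 < n) :
    Summable fun l : L.lattice ↦ (‖(l : ℂ)‖ ^ n)⁻¹ := by
  simpa using ZLattice.summable_norm_pow_inv L.lattice n (by simpa using hn)

lemma summable_norm_one_div_pow_four :
    Summable fun l : L.lattice ↦ ‖(1 : L.lattice → ℂ) l‖ / ‖(l : ℂ)‖ ^ 4 := by
  simpa using L.summable_norm_inv_pow (n := 4) (by norm_num)

section

variable {L} {c : L.lattice → ℂ}

lemma hasSum_weightedSum (hc : Summable fun l ↦ ‖c l‖ / ‖(l : ℂ)‖ ^ 4) {z : ℂ}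
    (hz : z ∈ ((L.lattice : Set ℂ) \ {0})ᶜ) :
    HasSum (fun l ↦ L.weightedSummand c l z) (L.weightedSum c z) := by
  obtain ⟨M, ε, hε, h⟩ := L.exists_norm_weightedSummand_le c hz
  exact (Summable.of_norm_bounded (hc.mul_left M) fun l ↦
    h l z (Metric.mem_ball_self hε)).hasSum

lemma differentiableOn_weightedSum (hc : Summable fun l ↦ ‖c l‖ / ‖(l : ℂ)‖ ^ 4) :
    DifferentiableOn ℂ (L.weightedSum c) ((L.lattice : Set ℂ) \ {0})ᶜ := by
  intro z hz
  obtain ⟨M, ε, hε, h⟩ := L.exists_norm_weightedSummand_le c hz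
  have hU : IsOpen (Metric.ball z ε ∩ ((L.lattice : Set ℂ) \ {0})ᶜ) :=
    Metric.isOpen_ball.inter L.isOpen_compl_lattice_sdiff
  exact ((Complex.differentiableOn_tsum_of_summable_norm (hc.mul_left M)
    (fun l ↦ (differentiableOn_weightedSummand c l).mono Set.inter_subset_right) hU
    fun l w hw ↦ h l w hw.1).differentiableAt
      (hU.mem_nhds ⟨Metric.mem_ball_self hε, hz⟩)).differentiableWithinAt

end

lemma hasSum_zetaRemainder {z : ℂ} (hz : z ∈ ((L.lattice : Set ℂ) \ {0})ᶜ) :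
    HasSum (fun l : L.lattice ↦ 1 / ((z - l) * (l : ℂ) ^ 3)) (L.zetaRemainder z) := by
  obtain ⟨M, ε, hε, h⟩ := L.exists_norm_zetaRemainder_summand_le hz
  exact (Summable.of_norm_bounded (L.summable_norm_one_div_pow_four.mul_left M) fun l ↦
    h l z (Metric.mem_ball_self hε)).hasSum

lemma hasDerivAt_zetaRemainder {z : ℂ} (hz : z ∈ ((L.lattice : Set ℂ) \ {0})ᶜ) :
    HasDerivAt L.zetaRemainder (deriv L.zetaRemainder z) z ∧
      HasSum (fun l : L.lattice ↦ -1 / ((z - l) ^ 2 * (l : ℂ) ^ 3)) (deriv L.zetaRemainder z) := by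
  obtain ⟨M, ε, hε, h⟩ := L.exists_norm_zetaRemainder_summand_le hz
  have hU : IsOpen (Metric.ball z ε ∩ ((L.lattice : Set ℂ) \ {0})ᶜ) :=
    Metric.isOpen_ball.inter L.isOpen_compl_lattice_sdiff
  have hzU : z ∈ Metric.ball z ε ∩ ((L.lattice : Set ℂ) \ {0})ᶜ := ⟨Metric.mem_ball_self hε, hz⟩
  have hd (l : L.lattice) : DifferentiableOn ℂ (fun w : ℂ ↦ 1 / ((w - l) * (l : ℂ) ^ 3))
      (Metric.ball z ε ∩ ((L.lattice : Set ℂ) \ {0})ᶜ) := fun w hw ↦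
    (hasDerivAt_zetaRemainder_summand l hw.2).differentiableAt.differentiableWithinAt
  constructor
  · exact ((Complex.differentiableOn_tsum_of_summable_norm
      (L.summable_norm_one_div_pow_four.mul_left M) hd hU
      fun l w hw ↦ h l w hw.1).differentiableAt (hU.mem_nhds hzU)).hasDerivAt
  · have := Complex.hasSum_deriv_of_summable_norm
      (L.summable_norm_one_div_pow_four.mul_left M) hd hU (fun l w hw ↦ h l w hw.1) hzU
    simp only [fun l : L.lattice ↦ (hasDerivAt_zetaRemainder_summand l hz).deriv] at this
    exact this

/-! ### Expansions of `℘`, `ζ` and `℘'` around the origin -/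

lemma hasSum_inv_pow_three : HasSum (fun l : L.lattice ↦ ((l : ℂ) ^ 3)⁻¹) 0 := by
  have := L.hasSum_sumInvPow 0 (r := 3) (by norm_num)
  simpa [L.G_eq_zero_of_odd 3 (by decide)] using this

lemma hasSum_inv_pow_four : HasSum (fun l : L.lattice ↦ ((l : ℂ) ^ 4)⁻¹) (L.G 4) := by
  simpa using L.hasSum_sumInvPow 0 (r := 4) (by norm_num)

lemma zero_mem_compl_lattice_sdiff : (0 : ℂ) ∈ ((L.lattice : Set ℂ) \ {0})ᶜ := by simp

lemma zetaRemainder_zero : L.zetaRemainder 0 = -L.G 4 := by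
  refine (L.hasSum_zetaRemainder L.zero_mem_compl_lattice_sdiff).unique ?_
  convert! L.hasSum_inv_pow_four.neg using 2 with l
  simp; ring

lemma weightedSum_one_zero : L.weightedSum 1 0 = 3 * L.G 4 := by
  refine (hasSum_weightedSum L.summable_norm_one_div_pow_four
    L.zero_mem_compl_lattice_sdiff).unique ?_
  convert! L.hasSum_inv_pow_four.mul_left 3 using 2 with l
  simp [weightedSummand]; ring

variable {L} in
lemma mem_compl_sdiff_of_notMem {z : ℂ} (hz : z ∉ L.lattice) :
    z ∈ ((L.lattice : Set ℂ) \ {0})ᶜ := fun h ↦ hz h.1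

variable {L} in
lemma ne_zero_of_notMem {z : ℂ} (hz : z ∉ L.lattice) : z ≠ 0 := by
  rintro rfl
  exact hz (zero_mem _)

lemma sq_mul_weightedSummand (c : L.lattice → ℂ) {l : L.lattice} (hl : l ≠ 0) {z : ℂ}
    (hz : z - l ≠ 0) :
    z ^ 2 * L.weightedSummand c l z = c l * (1 / (z - l) ^ 2 - 1 / l ^ 2 - 2 * z / l ^ 3) := by
  have hl' : (l : ℂ) ≠ 0 := by simpa using hl
  rw [weightedSummand]
  field_simp
  ring

/-- The extra term -2z/l³ of the weighted sum costs nothing, since ∑ l⁻³ = 0 by oddness. -/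
lemma weierstrassPExcept_zero_eq {z : ℂ} (hz : z ∈ ((L.lattice : Set ℂ) \ {0})ᶜ) :
    L.weierstrassPExcept 0 z = z ^ 2 * L.weightedSum 1 z := by
  refine (L.hasSum_weierstrassPExcept 0 z).unique ?_
  have h := ((hasSum_weightedSum L.summable_norm_one_div_pow_four hz).mul_left (z ^ 2)).add
    (L.hasSum_inv_pow_three.mul_left (2 * z))
  rw [mul_zero, add_zero] at h
  convert! h using 2 with l
  · by_cases hl : l = 0
    · simp [hl, weightedSummand]
    · rw [sq_mul_weightedSummand _ _ hl (sub_coe_ne_zero hz hl), if_neg (by simpa using hl)]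
      simp; ring

lemma weierstrassP_eq {z : ℂ} (hz : z ∉ L.lattice) :
    L.weierstrassP z = 1 / z ^ 2 + z ^ 2 * L.weightedSum 1 z := by
  rw [← L.weierstrassPExcept_zero_eq (mem_compl_sdiff_of_notMem hz),
    ← L.weierstrassPExcept_add 0]
  simp; ring

/-- The zeta function of a period pair. -/
noncomputable abbrev zeta (z : ℂ) : ℂ := weierstrassZeta L.ω₁ L.ω₂ z

lemma tsum_ne_zero_eq_tsum (f : L.lattice → ℂ) (hf : f 0 = 0) :
    ∑' m : {m : ℤ × ℤ // m ≠ 0}, f (L.latticeEquivProd.symm m) = ∑' l, f l := by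
  rw [← L.latticeEquivProd.symm.toEquiv.tsum_eq f]
  refine tsum_subtype_eq_of_support_subset (s := {m : ℤ × ℤ | m ≠ 0})
    (f := fun m ↦ f (L.latticeEquivProd.symm m)) fun m hm h ↦ hm ?_
  simp [h, hf]

lemma hasSum_zeta_sub {z : ℂ} (hz : z ∉ L.lattice) :
    HasSum (fun l : L.lattice ↦ if l = 0 then 0 else 1 / (z - l) + 1 / l + z / l ^ 2)
      (z ^ 3 * L.zetaRemainder z) := by
  have hz' := mem_compl_sdiff_of_notMem hz
  have h := ((L.hasSum_zetaRemainder hz').mul_left (z ^ 3)).sub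
    (L.hasSum_inv_pow_three.mul_left (z ^ 2))
  rw [mul_zero, sub_zero] at h
  convert! h using 2 with l
  · by_cases hl : l = 0
    · simp [hl]
    · have hl' : (l : ℂ) ≠ 0 := by simpa using hl
      have := sub_coe_ne_zero hz' hl
      rw [if_neg hl]
      field_simp
      ring

lemma zeta_eq {z : ℂ} (hz : z ∉ L.lattice) :
    L.zeta z = 1 / z + z ^ 3 * L.zetaRemainder z := by
  rw [← (L.hasSum_zeta_sub hz).tsum_eq, ← L.tsum_ne_zero_eq_tsum _ (if_pos rfl)]
  unfold zeta weierstrassZeta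
  congr 1
  refine tsum_congr fun m ↦ ?_
  rw [if_neg (by simpa using m.2), latticeEquiv_symm_apply]

/-- Since 1/0 = 0, the summand at l = 0 is exactly the principal part 1/z. -/
lemma hasSum_zeta {z : ℂ} (hz : z ∉ L.lattice) :
    HasSum (fun l : L.lattice ↦ 1 / (z - l) + 1 / l + z / (l : ℂ) ^ 2) (L.zeta z) := by
  rw [zeta_eq L hz]
  convert! (hasSum_ite_eq (0 : L.lattice) (1 / z)).add (L.hasSum_zeta_sub hz) using 2 with l
  by_cases hl : l = 0 <;> simp [hl]

lemma isOpen_compl_lattice : IsOpen ((L.lattice : Set ℂ)ᶜ) := L.isClosed_lattice.isOpen_compl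

lemma hasDerivAt_zeta {z : ℂ} (hz : z ∉ L.lattice) :
    HasDerivAt L.zeta (-L.weierstrassP z) z := by
  have hz' := mem_compl_sdiff_of_notMem hz
  have hz0 := ne_zero_of_notMem hz
  obtain ⟨h1, h2⟩ := L.hasDerivAt_zetaRemainder hz'
  -- This is ζ' = -℘ with the principal parts removed and z² divided out; it holds term by term on
  -- writing z = (z - l) + l.
  have key : z * deriv L.zetaRemainder z + 3 * L.zetaRemainder z = -L.weightedSum 1 z := by
    refine ((h2.mul_left z).add ((L.hasSum_zetaRemainder hz').mul_left 3)).unique ?_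
    convert! (hasSum_weightedSum L.summable_norm_one_div_pow_four hz').neg using 2 with l
    by_cases hl : l = 0
    · simp [hl, weightedSummand]
    · have hl' : (l : ℂ) ≠ 0 := by simpa using hl
      have := sub_coe_ne_zero hz' hl
      rw [weightedSummand]
      field_simp
      simp
      ring
  have h3 := (hasDerivAt_inv hz0).add ((hasDerivAt_pow 3 z).mul h1)
  refine (h3.congr_of_eventuallyEq ?_).congr_deriv ?_
  · filter_upwards [L.isOpen_compl_lattice.mem_nhds hz] with w hw
    rw [zeta_eq L hw]
    simp
  · rw [weierstrassP_eq L hz]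
    simp
    linear_combination z ^ 2 * key

lemma derivWeierstrassP_eq {z : ℂ} (hz : z ∉ L.lattice) :
    L.derivWeierstrassP z = -2 / z ^ 3 + 2 * z * L.weightedSum 1 z
      + z ^ 2 * deriv (L.weightedSum 1) z := by
  have hz' := mem_compl_sdiff_of_notMem hz
  have h := L.eqOn_deriv_weierstrassPExcept_derivWeierstrassPExcept 0 hz'
  rw [← L.derivWeierstrassPExcept_sub 0 z]
  simp only [ZeroMemClass.coe_zero, sub_zero]
  rw [← h]
  have h1 := ((differentiableOn_weightedSum L.summable_norm_one_div_pow_four).differentiableAt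
    (L.isOpen_compl_lattice_sdiff.mem_nhds hz')).hasDerivAt
  have h2 : HasDerivAt (L.weierstrassPExcept 0) _ z :=
    ((hasDerivAt_pow 2 z).mul h1).congr_of_eventuallyEq (by
      filter_upwards [L.isOpen_compl_lattice_sdiff.mem_nhds hz'] with w hw
      rw [weierstrassPExcept_zero_eq L hw]
      rfl)
  rw [h2.deriv]
  simp
  ring

/-! ### Quasi-periods -/

lemma isPreconnected_compl_lattice_sdiff (s : Set ℂ) :
    IsPreconnected ((L.lattice : Set ℂ) \ s)ᶜ :=
  (Set.Countable.isConnected_compl_of_one_lt_rank (by simp)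
    (.mono Set.sdiff_subset
      (countable_of_Lindelof_of_discrete (X := L.lattice)))).isPreconnected

lemma isPreconnected_compl_lattice : IsPreconnected ((L.lattice : Set ℂ)ᶜ) := by
  simpa using L.isPreconnected_compl_lattice_sdiff ∅

variable {L} in
lemma add_coe_notMem {z : ℂ} (hz : z ∉ L.lattice) (l : L.lattice) : z + l ∉ L.lattice :=
  fun h ↦ hz (by simpa using sub_mem h l.2)

variable {L} in
lemma neg_notMem {z : ℂ} (hz : z ∉ L.lattice) : -z ∉ L.lattice :=
  fun h ↦ hz (by simpa using neg_mem h)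

/-- By periodicity of ℘ the difference ζ(z + l) - ζ(z) has derivative zero on a connected set, so
its value can be read off at ω₁/2. -/
lemma zeta_add_coe_aux {z : ℂ} (hz : z ∉ L.lattice) (l : L.lattice) :
    L.zeta (z + l) = L.zeta z + (L.zeta (L.ω₁ / 2 + l) - L.zeta (L.ω₁ / 2)) := by
  have hd (w : ℂ) (hw : w ∉ L.lattice) := L.hasDerivAt_zeta hw
  have hd' (w : ℂ) (hw : w ∉ L.lattice) :
      HasDerivAt (fun w ↦ L.zeta (w + l)) (-L.weierstrassP w) w := by
    simpa using (hd _ (add_coe_notMem hw l)).comp_add_const w (l : ℂ)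
  refine L.isOpen_compl_lattice.eqOn_of_deriv_eq (𝕜 := ℂ) L.isPreconnected_compl_lattice
    (f := fun w ↦ L.zeta (w + l))
    (g := fun w ↦ L.zeta w + (L.zeta (L.ω₁ / 2 + l) - L.zeta (L.ω₁ / 2)))
    (fun w hw ↦ (hd' w hw).differentiableAt.differentiableWithinAt)
    (fun w hw ↦ ((hd w hw).add_const _).differentiableAt.differentiableWithinAt)
    (fun w hw ↦ ?_) (x := L.ω₁ / 2) L.ω₁_div_two_notMem_lattice (by simp) hz
  rw [(hd' w hw).deriv, ((hd w hw).add_const _).deriv]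

/-- The quasi-period homomorphism `η`, with `ζ (z + l) = ζ z + η l`. -/
noncomputable def quasiPeriod : L.lattice →+ ℂ where
  toFun l := L.zeta (L.ω₁ / 2 + l) - L.zeta (L.ω₁ / 2)
  map_zero' := by simp
  map_add' l₁ l₂ := by
    have := L.zeta_add_coe_aux (add_coe_notMem L.ω₁_div_two_notMem_lattice l₁) l₂
    rw [Submodule.coe_add, ← add_assoc, this]
    ring

lemma zeta_add_coe {z : ℂ} (hz : z ∉ L.lattice) (l : L.lattice) :
    L.zeta (z + l) = L.zeta z + L.quasiPeriod l := L.zeta_add_coe_aux hz l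

lemma zeta_neg {z : ℂ} (hz : z ∉ L.lattice) : L.zeta (-z) = -L.zeta z := by
  refine (L.hasSum_zeta (neg_notMem hz)).unique ?_
  rw [← (Equiv.neg L.lattice).hasSum_iff]
  convert! (L.hasSum_zeta hz).neg using 2 with l
  have : -z - -(l : ℂ) = -(z - l) := by ring
  simp only [Function.comp_apply, Equiv.neg_apply, NegMemClass.coe_neg, this, one_div, inv_neg,
    neg_sq, neg_div]
  ring

lemma quasiPeriod_eq_two_mul_zeta {l : L.lattice} (hl : (l : ℂ) / 2 ∉ L.lattice) :
    L.quasiPeriod l = 2 * L.zeta (l / 2) := by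
  -- Translating -l/2 by l gives l/2, and ζ is odd.
  have h := L.zeta_add_coe (neg_notMem hl) l
  rw [L.zeta_neg hl, show -((l : ℂ) / 2) + l = l / 2 by ring] at h
  linear_combination -h

lemma quasiPeriod_ω₁ : L.quasiPeriod ⟨L.ω₁, L.ω₁_mem_lattice⟩ = weierstrassEta₁ L.ω₁ L.ω₂ :=
  L.quasiPeriod_eq_two_mul_zeta L.ω₁_div_two_notMem_lattice

lemma quasiPeriod_ω₂ : L.quasiPeriod ⟨L.ω₂, L.ω₂_mem_lattice⟩ = weierstrassEta₂ L.ω₁ L.ω₂ :=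
  L.quasiPeriod_eq_two_mul_zeta L.ω₂_div_two_notMem_lattice

/-! ### Additive weights -/

/-- The first coordinate of a lattice point, as a complex number. -/
noncomputable def coord₁ : L.lattice →+ ℂ :=
  (Int.castAddHom ℂ).comp ((AddMonoidHom.fst ℤ ℤ).comp L.latticeEquivProd.toAddEquiv.toAddMonoidHom)

/-- The second coordinate of a lattice point, as a complex number. -/
noncomputable def coord₂ : L.lattice →+ ℂ :=
  (Int.castAddHom ℂ).comp ((AddMonoidHom.snd ℤ ℤ).comp L.latticeEquivProd.toAddEquiv.toAddMonoidHom)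

lemma coord₁_apply (l : L.lattice) : L.coord₁ l = (L.latticeEquivProd l).1 := rfl

lemma coord₂_apply (l : L.lattice) : L.coord₂ l = (L.latticeEquivProd l).2 := rfl

lemma coe_eq_zsmul_add_zsmul (l : L.lattice) :
    l = (L.latticeEquivProd l).1 • (⟨L.ω₁, L.ω₁_mem_lattice⟩ : L.lattice)
      + (L.latticeEquivProd l).2 • (⟨L.ω₂, L.ω₂_mem_lattice⟩ : L.lattice) := by
  ext
  have := L.latticeEquiv_symm_apply (L.latticeEquivProd l)
  simpa using this

variable {L} in
lemma addMonoidHom_apply (c : L.lattice →+ ℂ) (l : L.lattice) :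
    c l = L.coord₁ l * c ⟨L.ω₁, L.ω₁_mem_lattice⟩ + L.coord₂ l * c ⟨L.ω₂, L.ω₂_mem_lattice⟩ := by
  conv_lhs => rw [L.coe_eq_zsmul_add_zsmul l]
  rw [map_add, map_zsmul, map_zsmul, coord₁_apply, coord₂_apply, zsmul_eq_mul, zsmul_eq_mul]

variable {L} in
-- Linear growth of c makes |c(l)|/|l|⁴ comparable to |l|⁻³, which is summable.
lemma exists_norm_le_mul_norm (c : L.lattice →+ ℂ) :
    ∃ C > 0, ∀ l : L.lattice, ‖c l‖ ≤ C * ‖(l : ℂ)‖ := by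
  set b := (ZLattice.normBound L.latticeBasis)⁻¹
  have hb : 0 < b := inv_pos.mpr (ZLattice.normBound_pos _)
  have h (l : L.lattice) : ‖L.coord₁ l‖ ≤ b * ‖(l : ℂ)‖ ∧ ‖L.coord₂ l‖ ≤ b * ‖(l : ℂ)‖ := by
    constructor
    · have := ZLattice.abs_repr_le L.latticeBasis l 0
      rw [coord₁_apply, Complex.norm_intCast]
      exact_mod_cast this
    · have := ZLattice.abs_repr_le L.latticeBasis l 1
      rw [coord₂_apply, Complex.norm_intCast]
      exact_mod_cast this
  refine ⟨b * (‖c ⟨L.ω₁, L.ω₁_mem_lattice⟩‖ + ‖c ⟨L.ω₂, L.ω₂_mem_lattice⟩‖ + 1),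
    by positivity, fun l ↦ ?_⟩
  calc ‖c l‖ ≤ ‖L.coord₁ l‖ * ‖c ⟨L.ω₁, L.ω₁_mem_lattice⟩‖
        + ‖L.coord₂ l‖ * ‖c ⟨L.ω₂, L.ω₂_mem_lattice⟩‖ := by
        rw [addMonoidHom_apply c l, ← norm_mul, ← norm_mul]
        exact norm_add_le _ _
    _ ≤ (b * ‖(l : ℂ)‖) * ‖c ⟨L.ω₁, L.ω₁_mem_lattice⟩‖
        + (b * ‖(l : ℂ)‖) * ‖c ⟨L.ω₂, L.ω₂_mem_lattice⟩‖ := by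
        gcongr
        exacts [(h l).1, (h l).2]
    _ ≤ _ := by
        have : 0 ≤ b * ‖(l : ℂ)‖ := by positivity
        linarith

variable {L} in
lemma summable_addMonoidHom (c : L.lattice →+ ℂ) :
    Summable fun l ↦ ‖c l‖ / ‖(l : ℂ)‖ ^ 4 := by
  obtain ⟨C, hC, h⟩ := exists_norm_le_mul_norm c
  refine .of_nonneg_of_le (fun l ↦ by positivity) (fun l ↦ ?_)
    ((L.summable_norm_inv_pow (n := 3) (by norm_num)).mul_left C)
  by_cases hl : l = 0
  · simp [hl]
  have hl' : 0 < ‖(l : ℂ)‖ := by simpa using hl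
  rw [div_le_iff₀ (by positivity)]
  refine (h l).trans (le_of_eq ?_)
  field_simp

variable {L} in
lemma hasSum_sq_mul_weightedSum (c : L.lattice →+ ℂ) {z : ℂ} (hz : z ∉ L.lattice) :
    HasSum (fun l : L.lattice ↦ c l * (1 / (z - l) ^ 2 - 1 / (l : ℂ) ^ 2 - 2 * z / (l : ℂ) ^ 3))
      (z ^ 2 * L.weightedSum c z) := by
  have hz' := mem_compl_sdiff_of_notMem hz
  convert! (hasSum_weightedSum (summable_addMonoidHom c) hz').mul_left (z ^ 2) using 2 with l
  by_cases hl : l = 0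
  · simp [hl, weightedSummand]
  · rw [sq_mul_weightedSummand _ _ hl (sub_coe_ne_zero hz' hl)]

variable {L} in
lemma weightedSum_eq (c : L.lattice →+ ℂ) {z : ℂ} (hz : z ∉ L.lattice) :
    L.weightedSum c z = L.weightedSum L.coord₁ z * c ⟨L.ω₁, L.ω₁_mem_lattice⟩ +
      L.weightedSum L.coord₂ z * c ⟨L.ω₂, L.ω₂_mem_lattice⟩ := by
  have hz' := mem_compl_sdiff_of_notMem hz
  refine (hasSum_weightedSum (summable_addMonoidHom c) hz').unique ?_
  convert! ((hasSum_weightedSum (summable_addMonoidHom L.coord₁) hz').mul_right _).add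
    ((hasSum_weightedSum (summable_addMonoidHom L.coord₂) hz').mul_right _) using 2 with l
  simp only [weightedSummand, addMonoidHom_apply c l]
  ring

/-- Termwise, l/(z-l)² = z/(z-l)² - 1/(z-l). This is Euler's relation for ζ, homogeneous of degree
-1. -/
lemma sq_mul_weightedSum_subtype {z : ℂ} (hz : z ∉ L.lattice) :
    z ^ 2 * L.weightedSum L.lattice.subtype.toAddMonoidHom z
      = z * L.weierstrassP z - L.zeta z := by
  refine (hasSum_sq_mul_weightedSum _ hz).unique ?_
  convert! ((L.hasSum_weierstrassP z).mul_left z).sub (L.hasSum_zeta hz) using 2 with l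
  by_cases hl : l = 0
  · have := ne_zero_of_notMem hz
    simp [hl]
    field_simp
    simp
  · have hl' : (l : ℂ) ≠ 0 := by simpa using hl
    have := sub_coe_ne_zero (mem_compl_sdiff_of_notMem hz) hl
    simp
    field_simp
    ring

/-! ### Derivatives with respect to the periods -/

variable {L} in
lemma hasDerivAt_zeta_periods (c : L.lattice →+ ℂ) {z : ℂ} (hz : z ∉ L.lattice) :
    HasDerivAt (fun t : ℂ ↦ weierstrassZeta (L.ω₁ + t * c ⟨L.ω₁, L.ω₁_mem_lattice⟩)
      (L.ω₂ + t * c ⟨L.ω₂, L.ω₂_mem_lattice⟩) z) (z ^ 2 * L.weightedSum c z) 0 := by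
  have hz' := mem_compl_sdiff_of_notMem hz
  have hz0 := ne_zero_of_notMem hz
  let F (l : L.lattice) (t : ℂ) : ℂ :=
    if l = 0 then 0 else 1 / (z - (l + t * c l)) + 1 / (l + t * c l) + z / (l + t * c l) ^ 2
  have hF (t : ℂ) : weierstrassZeta (L.ω₁ + t * c ⟨L.ω₁, L.ω₁_mem_lattice⟩)
      (L.ω₂ + t * c ⟨L.ω₂, L.ω₂_mem_lattice⟩) z = 1 / z + ∑' l, F l t := by
    rw [← L.tsum_ne_zero_eq_tsum (fun l ↦ F l t) (if_pos rfl)]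
    unfold weierstrassZeta
    congr 1
    refine tsum_congr fun m ↦ ?_
    have h : (m.1.1 : ℂ) * (L.ω₁ + t * c ⟨L.ω₁, L.ω₁_mem_lattice⟩) +
        m.1.2 * (L.ω₂ + t * c ⟨L.ω₂, L.ω₂_mem_lattice⟩) =
        L.latticeEquivProd.symm m.1 + t * c (L.latticeEquivProd.symm m.1) := by
      rw [addMonoidHom_apply c (L.latticeEquivProd.symm m.1), coord₁_apply, coord₂_apply,
        latticeEquiv_symm_apply,
        LinearEquiv.apply_symm_apply]
      ring
    simp only [F]
    rw [if_neg (by simpa using m.2), h]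
  obtain ⟨a, ha, ε, hε, h⟩ := L.exists_mul_norm_le_norm_sub hz'
  replace h := h z (Metric.mem_ball_self hε)
  obtain ⟨C, hC, hc⟩ := exists_norm_le_mul_norm c
  -- This radius forces |t c(l)| ≤ min(a/2, 1/2)|l|, so both the moved point and its distance to z
  -- stay bounded below by multiples of |l|.
  set δ : ℝ := min (a / 2) (1 / 2) / C with hδ
  have hδ0 : 0 < δ := by positivity
  have hδC : δ * C = min (a / 2) (1 / 2) := by rw [hδ]; field_simp
  have hbound (l : L.lattice) (hl : l ≠ 0) (t : ℂ) (ht : t ∈ Metric.ball (0 : ℂ) δ) :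
      a / 2 * ‖(l : ℂ)‖ ≤ ‖z - (l + t * c l)‖ ∧ 1 / 2 * ‖(l : ℂ)‖ ≤ ‖l + t * c l‖ := by
    rw [mem_ball_zero_iff] at ht
    have h1 : ‖t * c l‖ ≤ min (a / 2) (1 / 2) * ‖(l : ℂ)‖ := by
      rw [norm_mul, ← hδC, mul_assoc]
      exact mul_le_mul ht.le (hc l) (norm_nonneg _) hδ0.le
    have h2 : min (a / 2) (1 / 2) * ‖(l : ℂ)‖ ≤ a / 2 * ‖(l : ℂ)‖ := by
      gcongr; exact min_le_left _ _
    have h3 : min (a / 2) (1 / 2) * ‖(l : ℂ)‖ ≤ 1 / 2 * ‖(l : ℂ)‖ := by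
      gcongr; exact min_le_right _ _
    constructor
    · have h4 := norm_sub_norm_le (z - l) (t * c l)
      have h5 := h l hl
      rw [show z - (l + t * c l) = z - l - t * c l by ring]
      linarith
    · have h4 := norm_sub_norm_le (l : ℂ) (-(t * c l))
      rw [sub_neg_eq_add, norm_neg] at h4
      linarith
  have hne (l : L.lattice) (hl : l ≠ 0) (t : ℂ) (ht : t ∈ Metric.ball (0 : ℂ) δ) :
      z - (l + t * c l) ≠ 0 ∧ l + t * c l ≠ 0 := by
    obtain ⟨h1, h2⟩ := hbound l hl t ht
    have hl' : 0 < ‖(l : ℂ)‖ := by simpa using hl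
    exact ⟨norm_pos_iff.mp (lt_of_lt_of_le (by positivity) h1),
      norm_pos_iff.mp (lt_of_lt_of_le (by positivity) h2)⟩
  have hderiv (l : L.lattice) (t : ℂ) (ht : t ∈ Metric.ball (0 : ℂ) δ) :
      HasDerivAt (F l) (c l * (1 / (z - (l + t * c l)) ^ 2 - 1 / (l + t * c l) ^ 2
        - 2 * z / (l + t * c l) ^ 3)) t := by
    by_cases hl : l = 0
    · have : F l = fun _ ↦ 0 := by ext; simp [F, hl]
      rw [this]
      simpa [hl] using hasDerivAt_const t (0 : ℂ)
    obtain ⟨h1, h2⟩ := hne l hl t ht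
    have : F l = fun t ↦ (z - (l + t * c l))⁻¹ + (l + t * c l)⁻¹ + z * ((l + t * c l) ^ 2)⁻¹ := by
      ext; simp [F, hl, div_eq_mul_inv]
    rw [this]
    have h3 : HasDerivAt (fun t ↦ (l : ℂ) + t * c l) (c l) t := by
      simpa using ((hasDerivAt_id t).mul_const (c l)).const_add (l : ℂ)
    refine (((h3.const_sub z).fun_inv h1).add (h3.fun_inv h2) |>.add
      (((h3.fun_pow 2).fun_inv (pow_ne_zero 2 h2)).const_mul z)).congr_deriv ?_
    simp
    field_simp
    ring
  have hsum : Summable fun l : L.lattice ↦ ‖z‖ ^ 2 * (a / 2 * (1 / 2) ^ 2)⁻¹ *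
      (‖(l : ℂ)‖ ^ 3)⁻¹ := (L.summable_norm_inv_pow (by norm_num)).mul_left _
  have hle (l : L.lattice) (t : ℂ) (ht : t ∈ Metric.ball (0 : ℂ) δ) :
      ‖F l t‖ ≤ ‖z‖ ^ 2 * (a / 2 * (1 / 2) ^ 2)⁻¹ * (‖(l : ℂ)‖ ^ 3)⁻¹ := by
    by_cases hl : l = 0
    · simp [F, hl]
    obtain ⟨h1, h2⟩ := hne l hl t ht
    obtain ⟨h3, h4⟩ := hbound l hl t ht
    have hl' : 0 < ‖(l : ℂ)‖ := by simpa using hl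
    -- The three terms collapse to a quantity of order |l|⁻³, which gives the majorant for termwise
    -- differentiation.
    have : F l t = z ^ 2 / ((z - (l + t * c l)) * (l + t * c l) ^ 2) := by
      simp only [F, if_neg hl]
      field_simp
      ring
    calc ‖F l t‖ = ‖z‖ ^ 2 / (‖z - (l + t * c l)‖ * ‖l + t * c l‖ ^ 2) := by rw [this]; simp
      _ ≤ ‖z‖ ^ 2 / ((a / 2 * ‖(l : ℂ)‖) * (1 / 2 * ‖(l : ℂ)‖) ^ 2) := by gcongr
      _ = _ := by field_simp
  have hd (l : L.lattice) : DifferentiableOn ℂ (F l) (Metric.ball 0 δ) := fun t ht ↦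
    (hderiv l t ht).differentiableAt.differentiableWithinAt
  have h0 : (0 : ℂ) ∈ Metric.ball (0 : ℂ) δ := Metric.mem_ball_self hδ0
  have hS := Complex.hasSum_deriv_of_summable_norm hsum hd Metric.isOpen_ball hle h0
  have hD := ((Complex.differentiableOn_tsum_of_summable_norm hsum hd Metric.isOpen_ball
    hle).differentiableAt (Metric.isOpen_ball.mem_nhds h0)).hasDerivAt
  simp only [fun l ↦ (hderiv l 0 h0).deriv, zero_mul, add_zero] at hS
  rw [hS.unique (hasSum_sq_mul_weightedSum c hz)] at hD
  exact (hD.const_add (1 / z)).congr_of_eventuallyEq (.of_forall hF)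

lemma hasDerivAt_zeta_ω₁ {z : ℂ} (hz : z ∉ L.lattice) :
    HasDerivAt (fun w ↦ weierstrassZeta w L.ω₂ z) (z ^ 2 * L.weightedSum L.coord₁ z) L.ω₁ := by
  have h := hasDerivAt_zeta_periods L.coord₁ hz
  rw [← sub_self L.ω₁] at h
  have h' := h.comp_sub_const L.ω₁ L.ω₁
  have h1 : L.latticeEquivProd ⟨L.ω₁, L.ω₁_mem_lattice⟩ = (1, 0) := by
    rw [← LinearEquiv.eq_symm_apply]; ext; simp [latticeEquiv_symm_apply]
  have h2 : L.latticeEquivProd ⟨L.ω₂, L.ω₂_mem_lattice⟩ = (0, 1) := by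
    rw [← LinearEquiv.eq_symm_apply]; ext; simp [latticeEquiv_symm_apply]
  simpa [coord₁_apply, h1, h2] using h'

lemma hasDerivAt_zeta_ω₂ {z : ℂ} (hz : z ∉ L.lattice) :
    HasDerivAt (fun w ↦ weierstrassZeta L.ω₁ w z) (z ^ 2 * L.weightedSum L.coord₂ z) L.ω₂ := by
  have h := hasDerivAt_zeta_periods L.coord₂ hz
  rw [← sub_self L.ω₂] at h
  have h' := h.comp_sub_const L.ω₂ L.ω₂
  have h1 : L.latticeEquivProd ⟨L.ω₁, L.ω₁_mem_lattice⟩ = (1, 0) := by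
    rw [← LinearEquiv.eq_symm_apply]; ext; simp [latticeEquiv_symm_apply]
  have h2 : L.latticeEquivProd ⟨L.ω₂, L.ω₂_mem_lattice⟩ = (0, 1) := by
    rw [← LinearEquiv.eq_symm_apply]; ext; simp [latticeEquiv_symm_apply]
  simpa [coord₂_apply, h1, h2] using h'

/-! ### The weighted sum of quasi-periods -/

variable {L} in
-- Reindexing by l ↦ l + l₀ and using additivity of c cancels every 1/(z-l)², leaving summands
-- affine in z.
lemma exists_sq_mul_weightedSum_add_coe (c : L.lattice →+ ℂ) (l₀ : L.lattice) :
    ∃ A B : ℂ, ∀ z ∉ L.lattice, (z + l₀) ^ 2 * L.weightedSum c (z + l₀)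
      = z ^ 2 * L.weightedSum c z + c l₀ * L.weierstrassP z + (A + B * z) := by
  let T (z : ℂ) : ℂ := (z + l₀) ^ 2 * L.weightedSum c (z + l₀) - z ^ 2 * L.weightedSum c z
    - c l₀ * L.weierstrassP z
  let b (l : L.lattice) : ℂ := -2 * c (l + l₀) / (l + l₀ : ℂ) ^ 3 + 2 * c l / (l : ℂ) ^ 3
  let a (l : L.lattice) : ℂ := -(c (l + l₀) / (l + l₀ : ℂ) ^ 2) - 2 * l₀ * c (l + l₀)
    / (l + l₀ : ℂ) ^ 3 + c l / (l : ℂ) ^ 2 + c l₀ / (l : ℂ) ^ 2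
  have hT (z : ℂ) (hz : z ∉ L.lattice) : HasSum (fun l ↦ a l + b l * z) (T z) := by
    have h := hasSum_sq_mul_weightedSum c (add_coe_notMem hz l₀)
    rw [← (Equiv.addRight l₀).hasSum_iff] at h
    convert! (h.sub (hasSum_sq_mul_weightedSum c hz)).sub
      ((L.hasSum_weierstrassP z).mul_left (c l₀)) using 2 with l
    simp only [Function.comp_apply, Equiv.coe_addRight, Submodule.coe_add, map_add, a, b,
      add_sub_add_right_eq_sub]
    ring
  -- Convergence is known only for a(l) + b(l)z; evaluating at ±ω₁/2 separates the two series.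
  have h1 := hT _ L.ω₁_div_two_notMem_lattice
  have h2 := hT _ (neg_notMem L.ω₁_div_two_notMem_lattice)
  have hω := L.ω₁_ne_zero
  obtain ⟨B, hb⟩ : ∃ B, HasSum b B := by
    refine ⟨(T (L.ω₁ / 2) - T (-(L.ω₁ / 2))) / L.ω₁, ?_⟩
    convert! (h1.sub h2).div_const L.ω₁ using 2 with l
    field_simp
    ring
  have ha := h1.sub (hb.mul_right (L.ω₁ / 2))
  simp only [add_sub_cancel_right] at ha
  refine ⟨T (L.ω₁ / 2) - B * (L.ω₁ / 2), B, fun z hz ↦ ?_⟩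
  have := (hT z hz).unique (ha.add (hb.mul_right z))
  linear_combination this

/-- The difference of the two sides in `PeriodPair.sq_mul_weightedSum_quasiPeriod`. -/
noncomputable def quasiPeriodDefect (z : ℂ) : ℂ :=
  z ^ 2 * L.weightedSum L.quasiPeriod z -
    (1 / 2 * L.derivWeierstrassP z + L.zeta z * L.weierstrassP z - L.g₂ / 12 * z)

/-! ### Vanishing of the quasi-period defect -/

variable {L} in
lemma weightedSum_neg (c : L.lattice →+ ℂ) {z : ℂ} (hz : z ∉ L.lattice) :
    L.weightedSum c (-z) = -L.weightedSum c z := by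
  refine (hasSum_weightedSum (summable_addMonoidHom c)
    (mem_compl_sdiff_of_notMem (neg_notMem hz))).unique ?_
  rw [← (Equiv.neg L.lattice).hasSum_iff]
  convert! (hasSum_weightedSum (summable_addMonoidHom c) (mem_compl_sdiff_of_notMem hz)).neg
    using 2 with l
  have h1 : (-z - -(l : ℂ)) ^ 2 * (-(l : ℂ)) ^ 2 = (z - l) ^ 2 * l ^ 2 := by ring
  have h2 : (-z - -(l : ℂ)) * (-(l : ℂ)) ^ 3 = (z - l) * l ^ 3 := by ring
  simp only [Function.comp_apply, Equiv.neg_apply, NegMemClass.coe_neg, weightedSummand, map_neg,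
    h1, h2]
  ring

lemma quasiPeriodDefect_neg {z : ℂ} (hz : z ∉ L.lattice) :
    L.quasiPeriodDefect (-z) = -L.quasiPeriodDefect z := by
  rw [quasiPeriodDefect, quasiPeriodDefect, weightedSum_neg _ hz, L.zeta_neg hz,
    L.weierstrassP_neg, L.derivWeierstrassP_neg]
  ring

lemma exists_quasiPeriodDefect_add_coe (l₀ : L.lattice) :
    ∃ A : ℂ, ∀ z ∉ L.lattice, L.quasiPeriodDefect (z + l₀) = L.quasiPeriodDefect z + A := by
  obtain ⟨A', B, h⟩ := exists_sq_mul_weightedSum_add_coe L.quasiPeriod l₀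
  set A := A' + L.g₂ / 12 * l₀
  have h' (z : ℂ) (hz : z ∉ L.lattice) :
      L.quasiPeriodDefect (z + l₀) = L.quasiPeriodDefect z + (A + B * z) := by
    rw [quasiPeriodDefect, quasiPeriodDefect, h z hz, L.zeta_add_coe hz, L.weierstrassP_add_coe,
      L.derivWeierstrassP_add_coe]
    simp only [A]
    ring
  -- Compare the translation rule at z with the rule at -(z + l₀), using oddness; since the result
  -- holds for several z, B must vanish.
  have hrefl (z : ℂ) (hz : z ∉ L.lattice) : 2 * B * z = -B * l₀ := by
    have h1 := h' _ (neg_notMem (add_coe_notMem hz l₀))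
    rw [show -(z + l₀) + l₀ = -z by ring, L.quasiPeriodDefect_neg hz,
      L.quasiPeriodDefect_neg (add_coe_notMem hz l₀)] at h1
    linear_combination h1 - h' z hz
  have hω := L.ω₁_ne_zero
  have hB : B = 0 := by
    have h1 := hrefl _ L.ω₁_div_two_notMem_lattice
    have h2 := hrefl _ (neg_notMem L.ω₁_div_two_notMem_lattice)
    have : B * L.ω₁ = 0 := by linear_combination (h1 - h2) / 2
    simpa [hω] using this
  exact ⟨A, fun z hz ↦ by rw [h' z hz, hB]; ring⟩

/-- The extension of `PeriodPair.quasiPeriodDefect` through the origin. -/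
noncomputable def quasiPeriodDefectExtension (z : ℂ) : ℂ :=
  z * (z * L.weightedSum L.quasiPeriod z - 2 * L.weightedSum 1 z
    - z * deriv (L.weightedSum 1) z / 2 - L.zetaRemainder z
    - z ^ 4 * L.zetaRemainder z * L.weightedSum 1 z + 5 * L.G 4)

/-- The poles -1/z³ of ½℘' and 1/z³ of ζ℘ cancel. -/
lemma quasiPeriodDefect_eq {z : ℂ} (hz : z ∉ L.lattice) :
    L.quasiPeriodDefect z = L.quasiPeriodDefectExtension z := by
  have hz0 := ne_zero_of_notMem hz
  rw [quasiPeriodDefect, quasiPeriodDefectExtension, L.zeta_eq hz, L.weierstrassP_eq hz,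
    L.derivWeierstrassP_eq hz, g₂]
  field_simp
  ring

lemma differentiableOn_quasiPeriodDefectExtension_factor :
    DifferentiableOn ℂ (fun z ↦ z * L.weightedSum L.quasiPeriod z - 2 * L.weightedSum 1 z
      - z * deriv (L.weightedSum 1) z / 2 - L.zetaRemainder z
      - z ^ 4 * L.zetaRemainder z * L.weightedSum 1 z + 5 * L.G 4)
      ((L.lattice : Set ℂ) \ {0})ᶜ := by
  have h1 := differentiableOn_weightedSum (summable_addMonoidHom L.quasiPeriod)
  have h2 := differentiableOn_weightedSum L.summable_norm_one_div_pow_four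
  have h3 := h2.deriv L.isOpen_compl_lattice_sdiff
  have h4 : DifferentiableOn ℂ L.zetaRemainder ((L.lattice : Set ℂ) \ {0})ᶜ := fun z hz ↦
    (L.hasDerivAt_zetaRemainder hz).1.differentiableAt.differentiableWithinAt
  fun_prop

lemma differentiableOn_quasiPeriodDefectExtension :
    DifferentiableOn ℂ L.quasiPeriodDefectExtension ((L.lattice : Set ℂ) \ {0})ᶜ :=
  differentiableOn_id.mul L.differentiableOn_quasiPeriodDefectExtension_factor

lemma deriv_quasiPeriodDefectExtension_zero : deriv L.quasiPeriodDefectExtension 0 = 0 := by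
  have h := (L.differentiableOn_quasiPeriodDefectExtension_factor.differentiableAt
    (L.isOpen_compl_lattice_sdiff.mem_nhds L.zero_mem_compl_lattice_sdiff)).hasDerivAt
  have := ((hasDerivAt_id (0 : ℂ)).mul h).deriv
  refine this.trans ?_
  -- The factor at 0 is -6G₄ + G₄ + 5G₄ = 0; this is where the coefficient g₂/12 = 5G₄ is needed.
  simp [L.weightedSum_one_zero, L.zetaRemainder_zero]
  ring

open Classical in
/-- The derivative of `PeriodPair.quasiPeriodDefect`, continued by zero to the lattice. -/
noncomputable def derivQuasiPeriodDefect (z : ℂ) : ℂ :=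
  if z ∈ L.lattice then 0 else deriv L.quasiPeriodDefect z

lemma derivQuasiPeriodDefect_eq {z : ℂ} (hz : z ∈ ((L.lattice : Set ℂ) \ {0})ᶜ) :
    L.derivQuasiPeriodDefect z = deriv L.quasiPeriodDefectExtension z := by
  by_cases h : z ∈ L.lattice
  · obtain rfl : z = 0 := by by_contra h0; exact hz ⟨h, h0⟩
    rw [deriv_quasiPeriodDefectExtension_zero, derivQuasiPeriodDefect, if_pos h]
  · rw [derivQuasiPeriodDefect, if_neg h]
    refine EventuallyEq.deriv_eq ?_
    filter_upwards [L.isOpen_compl_lattice.mem_nhds h] with w hw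
    exact L.quasiPeriodDefect_eq hw

lemma derivQuasiPeriodDefect_add_coe (z : ℂ) (l : L.lattice) :
    L.derivQuasiPeriodDefect (z + l) = L.derivQuasiPeriodDefect z := by
  by_cases h : z ∈ L.lattice
  · rw [derivQuasiPeriodDefect, derivQuasiPeriodDefect, if_pos h, if_pos (add_mem h l.2)]
  · rw [derivQuasiPeriodDefect, derivQuasiPeriodDefect, if_neg h, if_neg (add_coe_notMem h l),
      ← deriv_comp_add_const]
    obtain ⟨A, hA⟩ := L.exists_quasiPeriodDefect_add_coe l
    refine (EventuallyEq.deriv_eq ?_).trans (deriv_add_const A)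
    filter_upwards [L.isOpen_compl_lattice.mem_nhds h] with w hw
    exact hA w hw

lemma differentiable_derivQuasiPeriodDefect : Differentiable ℂ L.derivQuasiPeriodDefect := by
  have h (z : ℂ) (hz : z ∈ ((L.lattice : Set ℂ) \ {0})ᶜ) :
      DifferentiableAt ℂ L.derivQuasiPeriodDefect z := by
    refine (((L.differentiableOn_quasiPeriodDefectExtension).deriv
      L.isOpen_compl_lattice_sdiff).differentiableAt
        (L.isOpen_compl_lattice_sdiff.mem_nhds hz)).congr_of_eventuallyEq ?_
    filter_upwards [L.isOpen_compl_lattice_sdiff.mem_nhds hz] with w hw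
    exact L.derivQuasiPeriodDefect_eq hw
  intro z
  by_cases hz : z ∈ L.lattice
  · have h0 := h 0 L.zero_mem_compl_lattice_sdiff
    rw [← sub_self z] at h0
    have h1 : DifferentiableAt ℂ (fun w ↦ L.derivQuasiPeriodDefect (w - z)) z :=
      h0.comp (f := fun w ↦ w - z) z (by fun_prop)
    convert! h1 using 1
    ext w
    simpa using L.derivQuasiPeriodDefect_add_coe (w - z) ⟨z, hz⟩
  · exact h z (mem_compl_sdiff_of_notMem hz)

/-- Liouville: an entire periodic function is bounded, hence equal to its value at 0. -/
lemma derivQuasiPeriodDefect_eq_zero (z : ℂ) : L.derivQuasiPeriodDefect z = 0 := by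
  have hd := L.differentiable_derivQuasiPeriodDefect
  exact (hd.apply_eq_apply_of_bounded (IsZLattice.isCompact_range_of_periodic L.lattice _
    hd.continuous fun z w hw ↦ L.derivQuasiPeriodDefect_add_coe z ⟨w, hw⟩).isBounded z 0).trans
    (if_pos (zero_mem _))

/-- The sum of the quasi-periods `η l` weighted by
`1 / (z - l) ^ 2 - 1 / l ^ 2 - 2 * z / l ^ 3` is `℘' z / 2 + ζ z * ℘ z - g₂ * z / 12`. -/
lemma sq_mul_weightedSum_quasiPeriod {z : ℂ} (hz : z ∉ L.lattice) :
    z ^ 2 * L.weightedSum L.quasiPeriod z =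
      1 / 2 * L.derivWeierstrassP z + L.zeta z * L.weierstrassP z - L.g₂ / 12 * z := by
  rw [← sub_eq_zero]
  refine (L.quasiPeriodDefect_eq hz).trans ?_
  rw [L.isOpen_compl_lattice_sdiff.is_const_of_deriv_eq_zero
    (L.isPreconnected_compl_lattice_sdiff {0}) L.differentiableOn_quasiPeriodDefectExtension
    (fun w hw ↦ by rw [← L.derivQuasiPeriodDefect_eq hw, L.derivQuasiPeriodDefect_eq_zero w]; rfl)
    (mem_compl_sdiff_of_notMem hz) L.zero_mem_compl_lattice_sdiff]
  simp [quasiPeriodDefectExtension]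

end PeriodPair

/-! ### The Legendre relation -/

lemma Finset.sum_Icc_neg_succ {M : Type*} [AddCommMonoid M] (f : ℤ → M) (N : ℕ) :
    ∑ n ∈ Finset.Icc (-(N + 1 : ℕ) : ℤ) (N + 1 : ℕ), f n
      = f (-(N + 1 : ℕ)) + f (N + 1 : ℕ) + ∑ n ∈ Finset.Icc (-N : ℤ) N, f n := by
  have h : Finset.Icc (-(N + 1 : ℕ) : ℤ) (N + 1 : ℕ) =
      insert (-(N + 1 : ℕ) : ℤ) (insert ((N + 1 : ℕ) : ℤ) (Finset.Icc (-N : ℤ) N)) := by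
    ext; simp only [Finset.mem_insert, Finset.mem_Icc]; omega
  rw [h, Finset.sum_insert (by simp only [Finset.mem_insert, Finset.mem_Icc]; omega),
    Finset.sum_insert (by simp only [Finset.mem_Icc]; omega), add_assoc]

lemma HasSum.tendsto_sum_Icc_neg {f : ℤ → ℂ} {a : ℂ} (h : HasSum f a) :
    Tendsto (fun N : ℕ ↦ ∑ n ∈ Finset.Icc (-N : ℤ) N, f n) atTop (𝓝 a) :=
  (h : Tendsto _ _ _).comp
    (by exact Finset.tendsto_Icc_neg_atTop_atTop.comp tendsto_natCast_atTop_atTop)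

/-- The case w = 0 serves the central row: the nonzero terms cancel in pairs, and 1/0 = 0 matches
`Complex.cot 0 = 0`. -/
lemma Complex.tendsto_sum_Icc_one_div_add {w : ℂ} (hw : w = 0 ∨ w ∈ Complex.integerComplement) :
    Tendsto (fun N : ℕ ↦ ∑ n ∈ Finset.Icc (-N : ℤ) N, 1 / (w + n)) atTop
      (𝓝 (Real.pi * Complex.cot (Real.pi * w))) := by
  have h (N : ℕ) : ∑ n ∈ Finset.Icc (-N : ℤ) N, 1 / (w + n)
      = 1 / w + ∑ n ∈ Finset.range N, (1 / (w - (n + 1)) + 1 / (w + (n + 1))) := by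
    induction N with
    | zero => simp
    | succ N ih =>
      rw [Finset.sum_Icc_neg_succ, ih, Finset.sum_range_succ]
      push_cast
      ring
  simp_rw [h]
  obtain rfl | hw := hw
  · have h0 (n : ℕ) : 1 / ((0 : ℂ) - (n + 1)) + 1 / (0 + (n + 1)) = 0 := by
      rw [zero_sub, zero_add, div_neg, neg_add_cancel]
    simp only [h0]
    simp [Complex.cot]
  · simpa [cotTerm] using (tendsto_logDeriv_euler_cot_sub hw).const_add (1 / w)

lemma Complex.cot_add_pi (z : ℂ) : Complex.cot (z + Real.pi) = Complex.cot z := by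
  rw [Complex.cot, Complex.cot, Complex.cos_add_pi, Complex.sin_add_pi, neg_div_neg_eq]

lemma Complex.cot_neg (z : ℂ) : Complex.cot (-z) = -Complex.cot z := by
  rw [Complex.cot, Complex.cot, Complex.cos_neg, Complex.sin_neg, div_neg]

lemma Complex.tendsto_cot_atImInfty {u : ℕ → ℂ} (hu : Tendsto (fun N ↦ (u N).im) atTop atTop) :
    Tendsto (fun N ↦ Complex.cot (u N)) atTop (𝓝 (-Complex.I)) := by
  have h : Tendsto (fun N ↦ Complex.exp (2 * Complex.I * u N)) atTop (𝓝 0) := by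
    refine tendsto_zero_iff_norm_tendsto_zero.mpr ?_
    simp only [Complex.norm_exp]
    refine Real.tendsto_exp_atBot.comp ?_
    have : Tendsto (fun N ↦ -2 * (u N).im) atTop atBot := hu.const_mul_atTop_of_neg (by norm_num)
    simpa using this
  simp only [Complex.cot_eq_exp_ratio]
  have h' := (h.add_const 1).div ((h.const_sub 1).const_mul Complex.I) (by simp)
  simpa using! h'

namespace PeriodPair

variable {L : PeriodPair}

lemma mul_ω₁_mem_lattice_iff {x : ℂ} :
    L.ω₁ * x ∈ L.lattice ↔ ∃ m n : ℤ, x = m + n * (L.ω₂ / L.ω₁) := by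
  have := L.ω₁_ne_zero
  rw [mem_lattice]
  refine exists₂_congr fun m n ↦ ?_
  rw [← mul_right_inj' this (b := x)]
  constructor
  · intro h; rw [← h]; field_simp
  · intro h; rw [h]; field_simp

lemma sub_mul_mem_integerComplement {x : ℂ} (hx : L.ω₁ * x ∉ L.lattice) (n : ℤ) :
    x - n * (L.ω₂ / L.ω₁) ∈ Complex.integerComplement := by
  rintro ⟨m, hm⟩
  exact hx (mul_ω₁_mem_lattice_iff.mpr ⟨m, n, by rw [hm]; ring⟩)

lemma mul_eq_zero_or_mem_integerComplement (hL : 0 < (L.ω₂ / L.ω₁).im) (n : ℤ) :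
    n * (L.ω₂ / L.ω₁) = 0 ∨ n * (L.ω₂ / L.ω₁) ∈ Complex.integerComplement := by
  by_cases hn : n = 0
  · simp [hn]
  · right
    rintro ⟨m, hm⟩
    have := congrArg Complex.im hm
    simp [hn, hL.ne'] at this

/-- Summation of the zeta function by rows. -/
lemma tendsto_sum_rows (hL : 0 < (L.ω₂ / L.ω₁).im) :
    ∃ S : ℤ → ℂ, ∀ x : ℂ, L.ω₁ * x ∉ L.lattice →
      Tendsto (fun N : ℕ ↦ ∑ n ∈ Finset.Icc (-N : ℤ) N,
        (Real.pi * Complex.cot (Real.pi * (x - n * (L.ω₂ / L.ω₁)))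
          + Real.pi * Complex.cot (Real.pi * (n * (L.ω₂ / L.ω₁))) + x * S n))
        atTop (𝓝 (L.ω₁ * L.zeta (L.ω₁ * x))) := by
  have hω := L.ω₁_ne_zero
  set τ := L.ω₂ / L.ω₁ with hτ
  have hS (n : ℤ) : Summable fun m : ℤ ↦ 1 / (n * τ + m) ^ 2 := by
    have := EisensteinSeries.linear_right_summable (n * τ) 1 (k := 2) le_rfl
    refine this.congr fun m ↦ ?_
    simp [zpow_ofNat]
  refine ⟨fun n ↦ ∑' m : ℤ, 1 / (n * τ + m) ^ 2, fun x hx ↦ ?_⟩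
  let f (p : ℤ × ℤ) : ℂ := 1 / ((x - p.1 * τ) - p.2) + 1 / (p.1 * τ + p.2)
    + x * (1 / (p.1 * τ + p.2) ^ 2)
  have hf : HasSum f (L.ω₁ * L.zeta (L.ω₁ * x)) := by
    have h := (L.hasSum_zeta hx).mul_left L.ω₁
    -- The swap puts the coefficient of ω₂ first, so that a row is a fixed multiple of τ plus all
    -- integers.
    rw [← ((Equiv.prodComm ℤ ℤ).trans L.latticeEquivProd.symm.toEquiv).hasSum_iff] at h
    convert! h using 1
    ext p
    have h1 : ((L.latticeEquivProd.symm (p.2, p.1) : L.lattice) : ℂ) =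
        L.ω₁ * (p.1 * τ + p.2) := by
      rw [latticeEquiv_symm_apply, hτ]; field_simp; ring
    simp only [Function.comp_apply, Equiv.trans_apply, Equiv.prodComm_apply, Prod.swap,
      LinearEquiv.coe_toEquiv, h1, f]
    rw [← mul_sub, mul_pow, sub_sub]
    generalize (p.1 : ℂ) * τ + p.2 = a
    simp only [mul_inv, div_eq_mul_inv]
    field_simp
  have hrow (n : ℤ) : HasSum (fun m ↦ f (n, m))
      (Real.pi * Complex.cot (Real.pi * (x - n * τ)) + Real.pi * Complex.cot (Real.pi * (n * τ))
        + x * ∑' m : ℤ, 1 / (n * τ + m) ^ 2) := by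
    have hs : Summable fun m ↦ f (n, m) := hf.summable.comp_injective (Prod.mk_right_injective n)
    have hS' := (hS n).mul_left x
    have hs' := hs.sub hS'
    -- Without the quadratic term the two simple fractions converge separately only as symmetric
    -- sums, each to a cotangent.
    have h1 : Tendsto (fun N : ℕ ↦ ∑ m ∈ Finset.Icc (-N : ℤ) N,
        (1 / ((x - n * τ) - m) + 1 / (n * τ + m))) atTop
        (𝓝 (Real.pi * Complex.cot (Real.pi * (x - n * τ))
          + Real.pi * Complex.cot (Real.pi * (n * τ)))) := by
      simp only [Finset.sum_add_distrib]
      refine Tendsto.add ?_ (Complex.tendsto_sum_Icc_one_div_add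
        (mul_eq_zero_or_mem_integerComplement hL n))
      refine (Complex.tendsto_sum_Icc_one_div_add
        (Or.inr (sub_mul_mem_integerComplement hx n))).congr fun N ↦ ?_
      refine Finset.sum_bij' (fun m _ ↦ -m) (fun m _ ↦ -m) ?_ ?_ ?_ ?_ ?_
      · intro m hm; simp only [Finset.mem_Icc] at hm ⊢; omega
      · intro m hm; simp only [Finset.mem_Icc] at hm ⊢; omega
      · simp
      · simp
      · intro m _; simp [← hτ]
    have h2 := hs'.hasSum.tendsto_sum_Icc_neg
    simp only [f, add_sub_cancel_right] at h2
    have h3 := tendsto_nhds_unique h2 h1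
    have h4 := hs'.hasSum.add hS'.hasSum
    simp only [sub_add_cancel] at h4
    convert! h4 using 1
    rw [tsum_mul_left]
    simp only [f, add_sub_cancel_right]
    rw [h3]
  exact (hf.prod_fiberwise hrow).tendsto_sum_Icc_neg

lemma _root_.Finset.sum_Icc_neg_of_odd {f : ℤ → ℂ} (hf : ∀ n, f (-n) = -f n) (N : ℕ) :
    ∑ n ∈ Finset.Icc (-N : ℤ) N, f n = 0 := by
  induction N with
  | zero =>
    have := hf 0
    simp only [neg_zero] at this
    simpa using self_eq_neg.mp this
  | succ N ih => rw [Finset.sum_Icc_neg_succ, ih, hf]; ring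

/-- The Legendre relation `η₁ ω₂ - η₂ ω₁ = 2 π i`. -/
lemma legendre_relation (hL : 0 < (L.ω₂ / L.ω₁).im) :
    weierstrassEta₁ L.ω₁ L.ω₂ * L.ω₂ - weierstrassEta₂ L.ω₁ L.ω₂ * L.ω₁
      = 2 * Real.pi * Complex.I := by
  have hω := L.ω₁_ne_zero
  obtain ⟨S, hS⟩ := tendsto_sum_rows hL
  set τ := L.ω₂ / L.ω₁ with hτ
  have e1 : L.ω₁ * (1 / 2) = L.ω₁ / 2 := by ring
  have e2 : L.ω₁ * (τ / 2) = L.ω₂ / 2 := by rw [hτ]; field_simp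
  have h1 := hS (1 / 2) (by rw [e1]; exact L.ω₁_div_two_notMem_lattice)
  have h2 := hS (τ / 2) (by rw [e2]; exact L.ω₂_div_two_notMem_lattice)
  rw [e1] at h1
  rw [e2] at h2
  have hodd (n : ℤ) : (Real.pi : ℂ) * Complex.cot (Real.pi * ((-n : ℤ) * τ))
      = -(Real.pi * Complex.cot (Real.pi * (n * τ))) := by
    rw [← mul_neg, ← Complex.cot_neg]; push_cast; ring_nf
  -- At x = 1/2 the cotangents are odd in n, by oddness and π-periodicity, so they cancel.
  have h1' (N : ℕ) : ∑ n ∈ Finset.Icc (-N : ℤ) N,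
      (Real.pi * Complex.cot (Real.pi * (1 / 2 - n * τ))
        + Real.pi * Complex.cot (Real.pi * (n * τ)) + 1 / 2 * S n)
      = 1 / 2 * ∑ n ∈ Finset.Icc (-N : ℤ) N, S n := by
    rw [Finset.sum_add_distrib, ← Finset.mul_sum, Finset.sum_Icc_neg_of_odd, zero_add]
    intro n
    rw [hodd]
    have : (Real.pi : ℂ) * (1 / 2 - (-n : ℤ) * τ) = -(Real.pi * (1 / 2 - n * τ)) + Real.pi := by
      push_cast; ring
    rw [this, Complex.cot_add_pi, Complex.cot_neg]
    ring
  -- The arguments are the half-odd multiples of πτ from (½ - N)πτ to (½ + N)πτ; all but the last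
  -- pair off with opposite signs.
  have htel (N : ℕ) : ∑ n ∈ Finset.Icc (-N : ℤ) N,
      Real.pi * Complex.cot (Real.pi * (τ / 2 - n * τ))
      = Real.pi * Complex.cot (Real.pi * (τ / 2 + N * τ)) := by
    induction N with
    | zero => simp
    | succ N ih =>
      rw [Finset.sum_Icc_neg_succ, ih]
      have : (Real.pi : ℂ) * (τ / 2 - ((N + 1 : ℕ) : ℤ) * τ) = -(Real.pi * (τ / 2 + N * τ)) := by
        push_cast; ring
      rw [this, Complex.cot_neg]
      push_cast
      ring_nf
  have h2' (N : ℕ) : ∑ n ∈ Finset.Icc (-N : ℤ) N,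
      (Real.pi * Complex.cot (Real.pi * (τ / 2 - n * τ))
        + Real.pi * Complex.cot (Real.pi * (n * τ)) + τ / 2 * S n)
      = Real.pi * Complex.cot (Real.pi * (τ / 2 + N * τ))
        + τ * (1 / 2 * ∑ n ∈ Finset.Icc (-N : ℤ) N, S n) := by
    rw [Finset.sum_add_distrib, Finset.sum_add_distrib, htel, Finset.sum_Icc_neg_of_odd hodd,
      ← Finset.mul_sum]
    ring
  simp only [h1'] at h1
  simp only [h2'] at h2
  have h3 : Tendsto (fun N : ℕ ↦ Complex.cot (Real.pi * (τ / 2 + N * τ))) atTop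
      (𝓝 (-Complex.I)) := by
    refine Complex.tendsto_cot_atImInfty ?_
    have h : Tendsto (fun N : ℕ ↦ Real.pi * (τ.im / 2 + N * τ.im)) atTop atTop :=
      (tendsto_atTop_add_const_left _ _
        (tendsto_natCast_atTop_atTop.atTop_mul_const hL)).const_mul_atTop Real.pi_pos
    refine h.congr fun N ↦ ?_
    simp
  -- In the limit, ω₁ζ(ω₂/2) = -πi + τω₁ζ(ω₁/2).
  have h4 := tendsto_nhds_unique h2 ((h3.const_mul _).add (h1.const_mul τ))
  have e3 : L.ω₁ * τ = L.ω₂ := by rw [hτ]; field_simp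
  unfold weierstrassEta₁ weierstrassEta₂
  unfold zeta at h4
  rw [← e3] at h4 ⊢
  linear_combination -2 * h4

end PeriodPair

/-! ### Solving for the two partial derivatives -/

theorem mainTheorem5 (L : PeriodPair) (hL : 0 < (L.ω₂ / L.ω₁).im) (z : ℂ) (hz : z ∉ L.lattice) :
    HasDerivAt (fun w : ℂ => weierstrassZeta w L.ω₂ z)
      (1 / (2 * (Real.pi : ℂ) * Complex.I) *
        (1 / 2 * L.ω₂ * L.derivWeierstrassP z
          + (L.ω₂ * weierstrassZeta L.ω₁ L.ω₂ z - weierstrassEta₂ L.ω₁ L.ω₂ * z) * L.weierstrassP z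
          + weierstrassEta₂ L.ω₁ L.ω₂ * weierstrassZeta L.ω₁ L.ω₂ z
          - L.ω₂ * L.g₂ / 12 * z)) L.ω₁ ∧
    HasDerivAt (fun w : ℂ => weierstrassZeta L.ω₁ w z)
      (-(1 / (2 * (Real.pi : ℂ) * Complex.I)) *
        (1 / 2 * L.ω₁ * L.derivWeierstrassP z
          + (L.ω₁ * weierstrassZeta L.ω₁ L.ω₂ z - weierstrassEta₁ L.ω₁ L.ω₂ * z) * L.weierstrassP z
          + weierstrassEta₁ L.ω₁ L.ω₂ * weierstrassZeta L.ω₁ L.ω₂ z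
          - L.ω₁ * L.g₂ / 12 * z)) L.ω₂ := by
  have hπ : 2 * (Real.pi : ℂ) * Complex.I ≠ 0 := Complex.two_pi_I_ne_zero
  have hleg := PeriodPair.legendre_relation hL
  have hη := L.sq_mul_weightedSum_quasiPeriod hz
  have hω := L.sq_mul_weightedSum_subtype hz
  rw [PeriodPair.weightedSum_eq _ hz, L.quasiPeriod_ω₁, L.quasiPeriod_ω₂] at hη
  rw [PeriodPair.weightedSum_eq _ hz] at hω
  simp only [LinearMap.toAddMonoidHom_coe, Submodule.subtype_apply] at hω
  unfold PeriodPair.zeta at hη hω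
  -- Cramer's rule for the system `hη`, `hω`, with the Legendre relation as its determinant.
  constructor
  · refine (L.hasDerivAt_zeta_ω₁ hz).congr_deriv ?_
    rw [one_div, eq_inv_mul_iff_mul_eq₀ hπ, ← hleg]
    linear_combination L.ω₂ * hη - weierstrassEta₂ L.ω₁ L.ω₂ * hω
  · refine (L.hasDerivAt_zeta_ω₂ hz).congr_deriv ?_
    rw [one_div, neg_mul, ← mul_neg, eq_inv_mul_iff_mul_eq₀ hπ, ← hleg]
    linear_combination weierstrassEta₁ L.ω₁ L.ω₂ * hω - L.ω₁ * hη
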